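/- Let $n\ge 0$ and $k\ge 1$ be integers, let $J:\mathbb{R}^n\to\mathbb{R}$ be convex and finite everywhere, and let $H_1,\dots,H_k:\mathbb{R}^n\to\mathbb{R}$ be continuous functions bounded below by a common affine function, i.e. there are $a\in\mathbb{R}^n$ and $b\in\mathbb{R}$ with $H_i(u)\ge\langle a,u\rangle+b$ for all $u\in\mathbb{R}^n$ and all $i$. For $f:\mathbb{R}^n\to\mathbb{R}\cup\{+\infty\}$ let $f^*(v)=\sup_{x\in\mathbb{R}^n}\{\langle v,x\rangle-f(x)\}$ denote the Fenchel–Legendre transform. For a continuous $H:\mathbb{R}^n\to\mathbb{R}$, a viscosity solution of the Cauchy problem $$\frac{\partial\varphi}{\partial t}+H(\nabla_x\varphi)=0\ \text{ in }\mathbb{R}^n\times(0,+\infty),\qquad \varphi(\cdot,0)=J \tag{$P_H$}$$ is a continuous function $\varphi:\mathbb{R}^n\times[0,+\infty)\to\mathbb{R}$ with $\varphi(\cdot,0)=J$ such that, for every $C^1$ function $\psi$ on $\mathbb{R}^n\times(0,+\infty)$, at every local maximum point (respectively local minimum point) of $\varphi-\psi$ in $\mathbb{R}^n\times(0,+\infty)$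 one has $\frac{\partial\psi}{\partial t}+H(\nabla_x\psi)\le 0$ (respectively $\ge 0$). Put $$\varphi_i(x,t)=(J^*+tH_i)^*(x),\qquad x\in\mathbb{R}^n,\ t\ge 0,\ i=1,\dots,k .$$ Then: 1. For each $i$, $\varphi_i$ is finite on $\mathbb{R}^n\times[0,+\infty)$, $\varphi_i(x,t)=-\min_{u\in\mathbb{R}^n}\{J^*(u)+tH_i(u)-\langle u,x\rangle\}$ (the minimum being attained), and $\varphi_i$ is a viscosity solution of $(P_{H_i})$. 2. For all $x\in\mathbb{R}^n$ and $t\ge 0$, $$\max_{i=1,\dots,k}\varphi_i(x,t)=-\min_{u\in\mathbb{R}^n}\Big\{J^*(u)+t\min_{i=1,\dots,k}H_i(u)-\langle u,x\rangle\Big\},$$ the minimum over $u$ being attained. In other words $\max_i\varphi_i(x,t)=\big(J^*+t\min_iH_i\big)^*(x)$, the function given by the Hopf formula for the (in general nonconvex) Hamiltonian $\min_iH_i$. 3. The function $\max_i\varphi_i$ is a viscosity solution of $(P_H)$ with $H=\min_{i=1,\dots,k}H_i$. -/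

import Mathlib

open scoped Gradient

/-- The Fenchel–Legendre transform `f*(v) = sup_x {⟨v, x⟩ - f x}` of an extended-real-valued
function on `ℝⁿ`. -/
noncomputable def fenchelConj {n : ℕ} (f : EuclideanSpace ℝ (Fin n) → EReal)
    (v : EuclideanSpace ℝ (Fin n)) : EReal :=
  ⨆ x : EuclideanSpace ℝ (Fin n), (((inner ℝ v x : ℝ) : EReal) - f x)

/-- The function `u ↦ J*(u) + t H(u)`, with values in the extended reals. -/
noncomputable def hopfDual {n : ℕ} (J H : EuclideanSpace ℝ (Fin n) → ℝ) (t : ℝ)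
    (u : EuclideanSpace ℝ (Fin n)) : EReal :=
  fenchelConj (fun y => ((J y : ℝ) : EReal)) u + ((t * H u : ℝ) : EReal)

/-- The function `φ(x, t) = (J* + t H)*(x)` given by the Hopf formula, as a real number.
(When the extended-real value is infinite this is the junk value `0`; finiteness is
asserted separately wherever the function is used.) -/
noncomputable def hopfFormula {n : ℕ} (J H : EuclideanSpace ℝ (Fin n) → ℝ)
    (x : EuclideanSpace ℝ (Fin n)) (t : ℝ) : ℝ :=
  (fenchelConj (hopfDual J H t) x).toReal

/-- `φ` is a viscosity subsolution of `∂φ/∂t + H(∇ₓ φ) = 0` in `ℝⁿ × (0, ∞)`: at every local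
maximum `(x₀, t₀)` of `φ - ψ`, with `ψ` a `C¹` test function, `∂ψ/∂t + H(∇ₓ ψ) ≤ 0`. -/
def IsViscositySubsolution {n : ℕ} (H : EuclideanSpace ℝ (Fin n) → ℝ)
    (φ : EuclideanSpace ℝ (Fin n) → ℝ → ℝ) : Prop :=
  ∀ ψ : EuclideanSpace ℝ (Fin n) → ℝ → ℝ,
    ContDiffOn ℝ 1 (Function.uncurry ψ) (Set.univ ×ˢ Set.Ioi (0 : ℝ)) →
    ∀ (x₀ : EuclideanSpace ℝ (Fin n)) (t₀ : ℝ), 0 < t₀ →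
      IsLocalMax (fun z : EuclideanSpace ℝ (Fin n) × ℝ => φ z.1 z.2 - ψ z.1 z.2) (x₀, t₀) →
      deriv (fun s => ψ x₀ s) t₀ + H (∇ (fun y => ψ y t₀) x₀) ≤ 0

/-- `φ` is a viscosity supersolution of `∂φ/∂t + H(∇ₓ φ) = 0` in `ℝⁿ × (0, ∞)`: at every local
minimum `(x₀, t₀)` of `φ - ψ`, with `ψ` a `C¹` test function, `∂ψ/∂t + H(∇ₓ ψ) ≥ 0`. -/
def IsViscositySupersolution {n : ℕ} (H : EuclideanSpace ℝ (Fin n) → ℝ)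
    (φ : EuclideanSpace ℝ (Fin n) → ℝ → ℝ) : Prop :=
  ∀ ψ : EuclideanSpace ℝ (Fin n) → ℝ → ℝ,
    ContDiffOn ℝ 1 (Function.uncurry ψ) (Set.univ ×ˢ Set.Ioi (0 : ℝ)) →
    ∀ (x₀ : EuclideanSpace ℝ (Fin n)) (t₀ : ℝ), 0 < t₀ →
      IsLocalMin (fun z : EuclideanSpace ℝ (Fin n) × ℝ => φ z.1 z.2 - ψ z.1 z.2) (x₀, t₀) →
      0 ≤ deriv (fun s => ψ x₀ s) t₀ + H (∇ (fun y => ψ y t₀) x₀)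

/-- `φ` is a (continuous) viscosity solution of the Cauchy problem
`∂φ/∂t + H(∇ₓ φ) = 0` in `ℝⁿ × (0, ∞)`, `φ(·, 0) = J` on `ℝⁿ`. -/
structure IsViscositySolution {n : ℕ} (J H : EuclideanSpace ℝ (Fin n) → ℝ)
    (φ : EuclideanSpace ℝ (Fin n) → ℝ → ℝ) : Prop where
  continuousOn : ContinuousOn (Function.uncurry φ) (Set.univ ×ˢ Set.Ici (0 : ℝ))
  initial : ∀ x, φ x 0 = J x
  subsolution : IsViscositySubsolution H φ
  supersolution : IsViscositySupersolution H φ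

/-- The pointwise minimum `min_i H_i` of finitely many Hamiltonians. -/
noncomputable def minHamiltonian {n k : ℕ} [NeZero k]
    (H : Fin k → EuclideanSpace ℝ (Fin n) → ℝ) (u : EuclideanSpace ℝ (Fin n)) : ℝ :=
  Finset.univ.inf' Finset.univ_nonempty (fun i => H i u)

/-- The pointwise maximum `max_i φ_i` of the solutions `φ_i` given by the Hopf formula with
Hamiltonian `H_i` and initial datum `J`. -/
noncomputable def maxHopf {n k : ℕ} [NeZero k] (J : EuclideanSpace ℝ (Fin n) → ℝ)
    (H : Fin k → EuclideanSpace ℝ (Fin n) → ℝ) (x : EuclideanSpace ℝ (Fin n)) (t : ℝ) : ℝ :=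
  Finset.univ.sup' Finset.univ_nonempty (fun i => hopfFormula J (H i) x t)

/-!
The Hopf formula writes `φ(x, t) = (J* + t H)*(x)` as a supremum of functions
`⟨u, x⟩ - m - t H(u)`, affine in `(x, t)`, over the pairs `(u, m)` with `J*(u) ≤ m`. Once this
supremum is known to be attained for `0 ≤ t` (`isGreatest_hopfFormula`), the viscosity
inequalities follow from attainment alone, in real arithmetic. Attainment is a compactness
argument: `J` is finite, so `J*` is superlinear, while `t H` is bounded below by an affine function;
hence the competing slopes `u` stay bounded, locally uniformly in `(x, t)` (`exists_norm_le_of_hopfAffine_le`). The same bound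
gives continuity up to `t = 0`, and the initial condition is biconjugation for the finite convex
function `J`.

*Subsolution.* If `φ - ψ` has a local maximum at `(x₀, t₀)`, the affine function optimal there
touches `φ` from below, so its gradient `(u, -H(u))` is that of `ψ`, and the equation holds with
equality.

*Supersolution.* If `φ - ψ` has a local minimum at `(x₀, t₀)` and `(p, q)` is the gradient of `ψ`
there, convexity of `φ` along the segment from `(x₀, t₀)` to `(y, 0)` gives
`⟨p, y - x₀⟩ - t₀ q ≤ J y - φ(x₀, t₀)` for every `y`. This is a bound on `J*(p)`, and comparing it
with the term `u = p` in the supremum defining `φ(x₀, t₀)` yields `q + H(p) ≥ 0`. Neither argument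
uses convexity of `H`.

*Several Hamiltonians.* For `0 ≤ t` suprema commute, so the maximum of the `φ_i` is the Hopf formula
for `min_i H_i` (`maxHopf_eq_hopfFormula`). That Hamiltonian is again continuous with an affine
lower bound, so the case of one Hamiltonian applies to it.
-/

open Set Filter Topology

/-- The epigraph `{(u, m) | J*(u) ≤ m}` of the Fenchel conjugate of a real-valued function `J`,
written without extended reals: `m` bounds `⟨u, y⟩ - J y` for every `y`. -/
def conjEpigraph {n : ℕ} (J : EuclideanSpace ℝ (Fin n) → ℝ) :
    Set (EuclideanSpace ℝ (Fin n) × ℝ) :=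
  {p | ∀ y, inner ℝ p.1 y - J y ≤ p.2}

/-- The value at `(x, t)` of the space-time affine function `⟨u, x⟩ - m - t H(u)` attached to the
pair `p = (u, m)`. -/
noncomputable def hopfAffine {n : ℕ} (H : EuclideanSpace ℝ (Fin n) → ℝ)
    (x : EuclideanSpace ℝ (Fin n)) (t : ℝ) (p : EuclideanSpace ℝ (Fin n) × ℝ) : ℝ :=
  inner ℝ p.1 x - p.2 - t * H p.1

/-! ### The conjugate of a finite convex function -/

section Conjugate

variable {n : ℕ} {J H : EuclideanSpace ℝ (Fin n) → ℝ}

theorem fenchelConj_coe_le_iff {u : EuclideanSpace ℝ (Fin n)} {m : ℝ} :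
    fenchelConj (fun y => ((J y : ℝ) : EReal)) u ≤ (m : EReal) ↔ (u, m) ∈ conjEpigraph J := by
  unfold fenchelConj conjEpigraph
  simp only [iSup_le_iff, mem_ofPred_eq]
  exact forall_congr' fun y => by norm_cast

theorem fenchelConj_coe_eq_top_or_coe (J : EuclideanSpace ℝ (Fin n) → ℝ)
    (u : EuclideanSpace ℝ (Fin n)) :
    fenchelConj (fun y => ((J y : ℝ) : EReal)) u = ⊤ ∨
      ∃ m : ℝ, fenchelConj (fun y => ((J y : ℝ) : EReal)) u = (m : EReal) ∧
        (u, m) ∈ conjEpigraph J := by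
  by_cases htop : fenchelConj (fun y => ((J y : ℝ) : EReal)) u = ⊤
  · exact Or.inl htop
  right
  have hbot : fenchelConj (fun y => ((J y : ℝ) : EReal)) u ≠ ⊥ := by
    have h : ((inner ℝ u 0 - J 0 : ℝ) : EReal) ≤ fenchelConj (fun y => ((J y : ℝ) : EReal)) u := by
      rw [EReal.coe_sub]
      exact le_iSup (fun y => ((inner ℝ u y : ℝ) : EReal) - ((J y : ℝ) : EReal)) 0
    exact fun h' => by simp [h'] at h
  have he := EReal.coe_toReal htop hbot
  exact ⟨_, he.symm, fenchelConj_coe_le_iff.1 he.ge⟩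

theorem isClosed_conjEpigraph (J : EuclideanSpace ℝ (Fin n) → ℝ) : IsClosed (conjEpigraph J) := by
  simp only [conjEpigraph, ofPred_forall]
  exact isClosed_iInter fun y => isClosed_le (by fun_prop) (by fun_prop)

theorem ConvexOn.continuous_of_univ (hJ : ConvexOn ℝ univ J) : Continuous J :=
  continuousOn_univ.1 (hJ.continuousOn isOpen_univ)

/-- The part of the biconjugation theorem that is needed: every value below `J x` is attained at
`x` by an affine minorant of `J`. -/
theorem ConvexOn.exists_mem_conjEpigraph (hJ : ConvexOn ℝ univ J) {x : EuclideanSpace ℝ (Fin n)}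
    {a : ℝ} (ha : a < J x) : ∃ p ∈ conjEpigraph J, inner ℝ p.1 x - p.2 = a := by
  obtain ⟨l, c, hle, heq⟩ := hJ.exists_affine_le_of_lt (𝕜 := ℝ) (mem_univ x) ha isClosed_univ
    (hJ.continuous_of_univ.lowerSemicontinuous.lowerSemicontinuousOn _)
  refine ⟨((InnerProductSpace.toDual ℝ _).symm l, -c), fun y => ?_, ?_⟩
  · have h := hle ⟨y, mem_univ y⟩
    simp only [Pi.add_apply, domRestrict_apply, Function.comp_apply, RCLike.re_to_real,
      Function.const_apply] at h
    simp only [InnerProductSpace.toDual_symm_apply]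
    linarith
  · simp only [InnerProductSpace.toDual_symm_apply]
    simp only [RCLike.re_to_real] at heq
    linarith

/-- Since `J` is bounded on balls, its conjugate grows faster than any multiple of the norm. -/
theorem exists_mul_norm_sub_le_of_mem_conjEpigraph (hJ : Continuous J) {r : ℝ} (hr : 0 ≤ r) :
    ∃ C, ∀ p ∈ conjEpigraph J, r * ‖p.1‖ - C ≤ p.2 := by
  obtain ⟨C, hC⟩ := (isCompact_closedBall (0 : EuclideanSpace ℝ (Fin n)) r).bddAbove_image
    hJ.continuousOn
  refine ⟨C, fun p hp => ?_⟩
  -- Testing the conjugate at the point of norm `r` in the direction of `p.1`.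
  have hmem : (r * ‖p.1‖⁻¹) • p.1 ∈ Metric.closedBall (0 : EuclideanSpace ℝ (Fin n)) r := by
    rw [mem_closedBall_zero_iff, norm_smul, Real.norm_eq_abs, abs_of_nonneg (by positivity),
      mul_assoc]
    exact mul_le_of_le_one_right hr inv_mul_le_one
  have h1 := hC (mem_image_of_mem J hmem)
  have h2 := hp ((r * ‖p.1‖⁻¹) • p.1)
  rw [real_inner_smul_right, real_inner_self_eq_norm_sq] at h2
  have h3 : r * ‖p.1‖⁻¹ * ‖p.1‖ ^ 2 = r * ‖p.1‖ := by
    by_cases h : ‖p.1‖ = 0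
    · simp [h]
    · field_simp
  linarith

/-- Coercivity, uniform for bounded `(x, t)`: the pairs whose affine function is at least that of a
fixed pair `p₁` have bounded slopes. -/
theorem exists_norm_le_of_hopfAffine_le (hJ : Continuous J)
    (hbdd : ∃ (a : EuclideanSpace ℝ (Fin n)) (b : ℝ), ∀ u, inner ℝ a u + b ≤ H u)
    (p₁ : EuclideanSpace ℝ (Fin n) × ℝ) (R T : ℝ) :
    ∃ M, ∀ x t, ‖x‖ ≤ R → 0 ≤ t → t ≤ T → ∀ p ∈ conjEpigraph J,
      hopfAffine H x t p₁ ≤ hopfAffine H x t p → ‖p.1‖ ≤ M := by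
  obtain ⟨a, b, hab⟩ := hbdd
  -- `⟨u, x⟩ - t H(u)` grows at most like `(|R| + |T| ‖a‖) ‖u‖`; the extra `1` leaves `‖p.1‖`
  -- itself to be bounded.
  obtain ⟨C, hC⟩ := exists_mul_norm_sub_le_of_mem_conjEpigraph hJ
    (r := |R| + |T| * ‖a‖ + 1) (by positivity)
  refine ⟨C + |T| * |b| + ‖p₁.1‖ * |R| + |p₁.2| + |T| * |H p₁.1|,
    fun x t hx ht htT p hp hle => ?_⟩
  have hxR : ‖x‖ ≤ |R| := hx.trans (le_abs_self R)
  have htT' : t ≤ |T| := htT.trans (le_abs_self T)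
  have hpx : inner ℝ p.1 x ≤ ‖p.1‖ * |R| :=
    (real_inner_le_norm _ _).trans (by gcongr)
  have hp₁x : -(‖p₁.1‖ * |R|) ≤ inner ℝ p₁.1 x := by
    have h1 := neg_le_of_abs_le (abs_real_inner_le_norm p₁.1 x)
    have h2 : ‖p₁.1‖ * ‖x‖ ≤ ‖p₁.1‖ * |R| := by gcongr
    linarith
  have hHp₁ : t * H p₁.1 ≤ |T| * |H p₁.1| :=
    (mul_le_mul_of_nonneg_left (le_abs_self _) ht).trans (by gcongr)
  have hHp : -(|T| * (‖a‖ * ‖p.1‖ + |b|)) ≤ t * H p.1 := by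
    have h1 := neg_le_of_abs_le (abs_real_inner_le_norm a p.1)
    have h2 := neg_abs_le b
    have h3 : t * -(‖a‖ * ‖p.1‖ + |b|) ≤ t * H p.1 :=
      mul_le_mul_of_nonneg_left (by linarith [hab p.1]) ht
    have h4 : t * (‖a‖ * ‖p.1‖ + |b|) ≤ |T| * (‖a‖ * ‖p.1‖ + |b|) := by gcongr
    linarith
  have hgrow := hC p hp
  have hp₁2 := le_abs_self p₁.2
  simp only [hopfAffine] at hle
  linarith

end Conjugate

/-! ### Attainment in the Hopf formula -/

section HopfFormula

variable {n : ℕ} {J H : EuclideanSpace ℝ (Fin n) → ℝ}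

/-- The pairs doing at least as well as a fixed one form a compact set: their slopes are bounded by
coercivity, and `m` lies between `-J 0` and a bound coming from the slopes. -/
theorem exists_isMaxOn_hopfAffine (hJ : ConvexOn ℝ univ J) (hH : Continuous H)
    (hbdd : ∃ (a : EuclideanSpace ℝ (Fin n)) (b : ℝ), ∀ u, inner ℝ a u + b ≤ H u)
    (x : EuclideanSpace ℝ (Fin n)) {t : ℝ} (ht : 0 ≤ t) :
    ∃ p ∈ conjEpigraph J, IsMaxOn (hopfAffine H x t) (conjEpigraph J) p := by
  obtain ⟨p₁, hp₁, -⟩ := hJ.exists_mem_conjEpigraph (x := 0) (sub_one_lt (J 0))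
  obtain ⟨M, hM⟩ := exists_norm_le_of_hopfAffine_le hJ.continuous_of_univ hbdd p₁ ‖x‖ t
  have hcont : Continuous (hopfAffine H x t) := by unfold hopfAffine; fun_prop
  obtain ⟨K, hK⟩ := (isCompact_closedBall (0 : EuclideanSpace ℝ (Fin n)) M).bddAbove_image
    (f := fun u => inner ℝ u x - t * H u) (by fun_prop)
  set S := conjEpigraph J ∩ {p | hopfAffine H x t p₁ ≤ hopfAffine H x t p}
  have hS : IsCompact S := by
    refine ((isCompact_closedBall (0 : EuclideanSpace ℝ (Fin n)) M).prod
      (isCompact_Icc (a := -J 0) (b := K - hopfAffine H x t p₁))).of_isClosed_subset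
      ((isClosed_conjEpigraph J).inter (isClosed_le continuous_const hcont)) fun p hp => ?_
    have hpM : p.1 ∈ Metric.closedBall (0 : EuclideanSpace ℝ (Fin n)) M :=
      mem_closedBall_zero_iff.2 (hM x t le_rfl ht le_rfl p hp.1 hp.2)
    refine ⟨hpM, ?_, ?_⟩
    · simpa using hp.1 0
    · have h1 := hK (mem_image_of_mem _ hpM)
      have h2 : hopfAffine H x t p₁ ≤ inner ℝ p.1 x - p.2 - t * H p.1 := hp.2
      linarith
  obtain ⟨p, hp, hmax⟩ := hS.exists_isMaxOn ⟨p₁, hp₁, le_refl (hopfAffine H x t p₁)⟩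
    hcont.continuousOn
  refine ⟨p, hp.1, fun q hq => ?_⟩
  by_cases hq' : hopfAffine H x t p₁ ≤ hopfAffine H x t q
  · exact hmax ⟨hq, hq'⟩
  · exact (not_le.1 hq').le.trans hp.2

theorem fenchelConj_hopfDual_eq_of_isMaxOn {x : EuclideanSpace ℝ (Fin n)} {t : ℝ}
    {p : EuclideanSpace ℝ (Fin n) × ℝ} (hp : p ∈ conjEpigraph J)
    (hmax : IsMaxOn (hopfAffine H x t) (conjEpigraph J) p) :
    fenchelConj (hopfDual J H t) x = (hopfAffine H x t p : EReal) := by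
  apply le_antisymm
  · refine iSup_le fun u => ?_
    rcases fenchelConj_coe_eq_top_or_coe J u with h | ⟨m, h, hm⟩
    · simp [hopfDual, h, -EReal.coe_mul]
    · have h' : inner ℝ u x - m - t * H u ≤ hopfAffine H x t p := hmax hm
      rw [hopfDual, h]
      norm_cast
      rw [real_inner_comm]
      linarith
  · refine le_trans ?_ (le_iSup _ p.1)
    have h : hopfDual J H t p.1 ≤ ((p.2 + t * H p.1 : ℝ) : EReal) := by
      rw [hopfDual, EReal.coe_add]
      gcongr
      exact fenchelConj_coe_le_iff.2 hp
    refine le_trans ?_ (EReal.sub_le_sub le_rfl h)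
    rw [← EReal.coe_sub, EReal.coe_le_coe_iff, real_inner_comm, hopfAffine]
    linarith

theorem isGreatest_hopfFormula (hJ : ConvexOn ℝ univ J) (hH : Continuous H)
    (hbdd : ∃ (a : EuclideanSpace ℝ (Fin n)) (b : ℝ), ∀ u, inner ℝ a u + b ≤ H u)
    (x : EuclideanSpace ℝ (Fin n)) {t : ℝ} (ht : 0 ≤ t) :
    IsGreatest (hopfAffine H x t '' conjEpigraph J) (hopfFormula J H x t) := by
  obtain ⟨p, hp, hmax⟩ := exists_isMaxOn_hopfAffine hJ hH hbdd x ht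
  rw [hopfFormula, fenchelConj_hopfDual_eq_of_isMaxOn hp hmax, EReal.toReal_coe]
  exact ⟨mem_image_of_mem _ hp, forall_mem_image.2 fun q hq => hmax hq⟩

theorem coe_hopfFormula (hJ : ConvexOn ℝ univ J) (hH : Continuous H)
    (hbdd : ∃ (a : EuclideanSpace ℝ (Fin n)) (b : ℝ), ∀ u, inner ℝ a u + b ≤ H u)
    (x : EuclideanSpace ℝ (Fin n)) {t : ℝ} (ht : 0 ≤ t) :
    ((hopfFormula J H x t : ℝ) : EReal) = fenchelConj (hopfDual J H t) x := by
  obtain ⟨p, hp, hmax⟩ := exists_isMaxOn_hopfAffine hJ hH hbdd x ht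
  rw [hopfFormula, fenchelConj_hopfDual_eq_of_isMaxOn hp hmax, EReal.toReal_coe]

theorem isLeast_neg_hopfFormula (hJ : ConvexOn ℝ univ J) (hH : Continuous H)
    (hbdd : ∃ (a : EuclideanSpace ℝ (Fin n)) (b : ℝ), ∀ u, inner ℝ a u + b ≤ H u)
    (x : EuclideanSpace ℝ (Fin n)) {t : ℝ} (ht : 0 ≤ t) :
    IsLeast (range fun u : EuclideanSpace ℝ (Fin n) =>
        fenchelConj (fun y => ((J y : ℝ) : EReal)) u + ((t * H u : ℝ) : EReal)
          - ((inner ℝ u x : ℝ) : EReal))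
      ((-hopfFormula J H x t : ℝ) : EReal) := by
  obtain ⟨⟨p, hp, hval⟩, hub⟩ := isGreatest_hopfFormula hJ hH hbdd x ht
  have hlow : ∀ u : EuclideanSpace ℝ (Fin n), ((-hopfFormula J H x t : ℝ) : EReal) ≤
      fenchelConj (fun y => ((J y : ℝ) : EReal)) u + ((t * H u : ℝ) : EReal)
        - ((inner ℝ u x : ℝ) : EReal) := by
    intro u
    rcases fenchelConj_coe_eq_top_or_coe J u with h | ⟨m, h, hm⟩
    · simp [h, -EReal.coe_mul, -EReal.coe_neg]
    · have h' : inner ℝ u x - m - t * H u ≤ hopfFormula J H x t := hub (mem_image_of_mem _ hm)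
      rw [h]
      norm_cast
      linarith
  refine ⟨⟨p.1, le_antisymm ?_ (hlow p.1)⟩, forall_mem_range.2 hlow⟩
  have h : fenchelConj (fun y => ((J y : ℝ) : EReal)) p.1 + ((t * H p.1 : ℝ) : EReal) ≤
      ((p.2 + t * H p.1 : ℝ) : EReal) := by
    rw [EReal.coe_add]
    gcongr
    exact fenchelConj_coe_le_iff.2 hp
  refine (EReal.sub_le_sub h le_rfl).trans ?_
  rw [← EReal.coe_sub, EReal.coe_le_coe_iff, ← hval, hopfAffine]
  linarith

end HopfFormula

/-! ### The viscosity solution property -/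

section Viscosity

variable {n : ℕ} {J H : EuclideanSpace ℝ (Fin n) → ℝ} {φ : EuclideanSpace ℝ (Fin n) → ℝ → ℝ}

theorem eq_initial_of_isGreatest (hJ : ConvexOn ℝ univ J) {x : EuclideanSpace ℝ (Fin n)}
    (hφ : IsGreatest (hopfAffine H x 0 '' conjEpigraph J) (φ x 0)) : φ x 0 = J x := by
  obtain ⟨⟨p, hp, hval⟩, hub⟩ := hφ
  apply le_antisymm
  · have h := hp x
    rw [← hval, hopfAffine]
    linarith
  · refine le_of_forall_lt_imp_le_of_dense fun a ha => ?_
    obtain ⟨q, hq, rfl⟩ := hJ.exists_mem_conjEpigraph ha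
    simpa [hopfAffine] using hub (mem_image_of_mem _ hq)

/-- At a given point, `φ` is squeezed between an affine function optimal there and a Lipschitz upper
bound, whose constants come from the boundedness of the slopes optimal at nearby points. -/
theorem continuousOn_of_isGreatest (hJ : Continuous J) (hH : Continuous H)
    (hbdd : ∃ (a : EuclideanSpace ℝ (Fin n)) (b : ℝ), ∀ u, inner ℝ a u + b ≤ H u)
    (hφ : ∀ x t, 0 ≤ t → IsGreatest (hopfAffine H x t '' conjEpigraph J) (φ x t)) :
    ContinuousOn (Function.uncurry φ) (univ ×ˢ Ici (0 : ℝ)) := by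
  rintro ⟨x₀, t₀⟩ ⟨-, ht₀ : 0 ≤ t₀⟩
  obtain ⟨⟨p₀, hp₀, hval₀⟩, hub₀⟩ := hφ x₀ t₀ ht₀
  obtain ⟨M, hM⟩ := exists_norm_le_of_hopfAffine_le hJ hbdd p₀ (‖x₀‖ + 1) (t₀ + 1)
  obtain ⟨K, hK⟩ := (isCompact_closedBall (0 : EuclideanSpace ℝ (Fin n)) M
    ).exists_bound_of_continuousOn hH.continuousOn
  have hnear : ∀ᶠ z : EuclideanSpace ℝ (Fin n) × ℝ in 𝓝[univ ×ˢ Ici (0 : ℝ)] (x₀, t₀),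
      ‖z.1‖ ≤ ‖x₀‖ + 1 ∧ 0 ≤ z.2 ∧ z.2 ≤ t₀ + 1 := by
    have h1 : ∀ᶠ z : EuclideanSpace ℝ (Fin n) × ℝ in 𝓝 (x₀, t₀), ‖z.1‖ < ‖x₀‖ + 1 :=
      (continuous_fst.norm.continuousAt).eventually_lt_const (lt_add_one _)
    have h2 : ∀ᶠ z : EuclideanSpace ℝ (Fin n) × ℝ in 𝓝 (x₀, t₀), z.2 < t₀ + 1 :=
      continuous_snd.continuousAt.eventually_lt_const (lt_add_one _)
    filter_upwards [h1.filter_mono nhdsWithin_le_nhds, h2.filter_mono nhdsWithin_le_nhds,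
      self_mem_nhdsWithin] with z hz1 hz2 hz3
    exact ⟨hz1.le, hz3.2, hz2.le⟩
  have hlo : Tendsto (fun z : EuclideanSpace ℝ (Fin n) × ℝ => hopfAffine H z.1 z.2 p₀)
      (𝓝[univ ×ˢ Ici (0 : ℝ)] (x₀, t₀)) (𝓝 (φ x₀ t₀)) := by
    have hc : Continuous fun z : EuclideanSpace ℝ (Fin n) × ℝ => hopfAffine H z.1 z.2 p₀ := by
      unfold hopfAffine; fun_prop
    exact hval₀ ▸ (hc.tendsto (x₀, t₀)).mono_left nhdsWithin_le_nhds
  have hhi : Tendsto (fun z : EuclideanSpace ℝ (Fin n) × ℝ =>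
      φ x₀ t₀ + M * ‖z.1 - x₀‖ + K * |z.2 - t₀|)
      (𝓝[univ ×ˢ Ici (0 : ℝ)] (x₀, t₀)) (𝓝 (φ x₀ t₀)) := by
    have hc : Continuous fun z : EuclideanSpace ℝ (Fin n) × ℝ =>
      φ x₀ t₀ + M * ‖z.1 - x₀‖ + K * |z.2 - t₀| := by fun_prop
    simpa using (hc.tendsto (x₀, t₀)).mono_left nhdsWithin_le_nhds
  refine tendsto_of_tendsto_of_tendsto_of_le_of_le' hlo hhi ?_ ?_
  · filter_upwards [hnear] with z hz
    exact (hφ z.1 z.2 hz.2.1).2 (mem_image_of_mem _ hp₀)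
  · filter_upwards [hnear] with z hz
    obtain ⟨⟨p, hp, hval⟩, hub⟩ := hφ z.1 z.2 hz.2.1
    -- A pair optimal at a nearby point has slope at most `M`, so moving the base point back to
    -- `(x₀, t₀)` changes its affine function by at most `M ‖x - x₀‖ + K |t - t₀|`.
    have hpM : ‖p.1‖ ≤ M := hM z.1 z.2 hz.1 hz.2.1 hz.2.2 p hp
      (hval ▸ hub (mem_image_of_mem _ hp₀))
    have hKp : |H p.1| ≤ K := hK p.1 (mem_closedBall_zero_iff.2 hpM)
    have h0 := hub₀ (mem_image_of_mem _ hp)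
    have h1 : inner ℝ p.1 (z.1 - x₀) ≤ M * ‖z.1 - x₀‖ :=
      (real_inner_le_norm _ _).trans (by gcongr)
    have h2 : -(K * |z.2 - t₀|) ≤ (z.2 - t₀) * H p.1 := by
      have h3 := neg_abs_le ((z.2 - t₀) * H p.1)
      have h4 : |z.2 - t₀| * |H p.1| ≤ |z.2 - t₀| * K := by gcongr
      rw [abs_mul] at h3
      linarith
    rw [inner_sub_right] at h1
    simp only [Function.uncurry, ← hval]
    simp only [hopfAffine] at h0 ⊢
    linarith

theorem differentiableAt_uncurry_of_contDiffOn {ψ : EuclideanSpace ℝ (Fin n) → ℝ → ℝ}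
    (hψ : ContDiffOn ℝ 1 (Function.uncurry ψ) (univ ×ˢ Ioi (0 : ℝ)))
    {x₀ : EuclideanSpace ℝ (Fin n)} {t₀ : ℝ} (ht₀ : 0 < t₀) :
    DifferentiableAt ℝ (Function.uncurry ψ) (x₀, t₀) :=
  (hψ.differentiableOn one_ne_zero).differentiableAt
    ((isOpen_univ.prod isOpen_Ioi).mem_nhds ⟨mem_univ _, ht₀⟩)

/-- The total derivative of a function of `(x, t)` in terms of its spatial gradient and its time
derivative. -/
theorem fderiv_uncurry_apply {ψ : EuclideanSpace ℝ (Fin n) → ℝ → ℝ}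
    {x₀ : EuclideanSpace ℝ (Fin n)} {t₀ : ℝ}
    (hψ : DifferentiableAt ℝ (Function.uncurry ψ) (x₀, t₀))
    (v : EuclideanSpace ℝ (Fin n)) (τ : ℝ) :
    fderiv ℝ (Function.uncurry ψ) (x₀, t₀) (v, τ) =
      inner ℝ (∇ (fun y => ψ y t₀) x₀) v + τ * deriv (fun s => ψ x₀ s) t₀ := by
  have hx : HasFDerivAt (fun y => ψ y t₀)
      ((fderiv ℝ (Function.uncurry ψ) (x₀, t₀)).comp (.inl ℝ _ ℝ)) x₀ :=
    HasFDerivAt.comp (f := fun y => (y, t₀)) x₀ hψ.hasFDerivAt (hasFDerivAt_prodMk_left x₀ t₀)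
  have ht : HasFDerivAt (fun s => ψ x₀ s)
      ((fderiv ℝ (Function.uncurry ψ) (x₀, t₀)).comp (.inr ℝ _ ℝ)) t₀ :=
    HasFDerivAt.comp (f := fun s => (x₀, s)) t₀ hψ.hasFDerivAt (hasFDerivAt_prodMk_right x₀ t₀)
  have hv : (v, τ) = (v, (0 : ℝ)) + τ • ((0 : EuclideanSpace ℝ (Fin n)), (1 : ℝ)) := by simp
  rw [gradient, InnerProductSpace.toDual_symm_apply, hx.fderiv, ht.hasDerivAt.deriv, hv, map_add,
    map_smul]
  simp

/-- An affine function optimal at the contact point touches `φ` from below, so it inherits the local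
maximum and the equation holds there with equality. -/
theorem isViscositySubsolution_of_isGreatest
    (hφ : ∀ x t, 0 ≤ t → IsGreatest (hopfAffine H x t '' conjEpigraph J) (φ x t)) :
    IsViscositySubsolution H φ := by
  intro ψ hψ x₀ t₀ ht₀ hmax
  have hd := differentiableAt_uncurry_of_contDiffOn hψ (x₀ := x₀) ht₀
  obtain ⟨⟨p, hp, hval⟩, -⟩ := hφ x₀ t₀ ht₀.le
  have hpos : ∀ᶠ z : EuclideanSpace ℝ (Fin n) × ℝ in 𝓝 (x₀, t₀), 0 < z.2 :=
    continuous_snd.continuousAt.eventually_const_lt ht₀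
  have hmax' : IsLocalMax (fun z : EuclideanSpace ℝ (Fin n) × ℝ =>
      hopfAffine H z.1 z.2 p - Function.uncurry ψ z) (x₀, t₀) := by
    filter_upwards [hmax, hpos] with z hz hz2
    have h := (hφ z.1 z.2 hz2.le).2 (mem_image_of_mem _ hp)
    simp only [Function.uncurry] at hz ⊢
    linarith
  have hder : HasFDerivAt (fun z : EuclideanSpace ℝ (Fin n) × ℝ => hopfAffine H z.1 z.2 p)
      ((innerSL ℝ p.1).comp (ContinuousLinearMap.fst ℝ _ ℝ) -
        (H p.1) • ContinuousLinearMap.snd ℝ (EuclideanSpace ℝ (Fin n)) ℝ) (x₀, t₀) := by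
    have h := (((innerSL ℝ p.1).comp (ContinuousLinearMap.fst ℝ _ ℝ) -
      (H p.1) • ContinuousLinearMap.snd ℝ (EuclideanSpace ℝ (Fin n)) ℝ).hasFDerivAt
        (x := (x₀, t₀))).sub_const p.2
    refine h.congr_of_eventuallyEq (Eventually.of_forall fun z => ?_)
    simp [hopfAffine]
    ring
  have hzero := hmax'.hasFDerivAt_eq_zero (hder.sub hd.hasFDerivAt)
  have hall : ∀ (v : EuclideanSpace ℝ (Fin n)) (τ : ℝ), inner ℝ p.1 v - H p.1 * τ -
      (inner ℝ (∇ (fun y => ψ y t₀) x₀) v + τ * deriv (fun s => ψ x₀ s) t₀) = 0 := by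
    intro v τ
    have h := DFunLike.congr_fun hzero (v, τ)
    rw [← fderiv_uncurry_apply hd v τ]
    simpa using h
  have hgrad : ∇ (fun y => ψ y t₀) x₀ = p.1 :=
    ext_inner_right ℝ fun v => by
      have h := hall v 0
      simp only [mul_zero, zero_mul] at h
      linarith
  have htime := hall 0 1
  simp only [inner_zero_right] at htime
  rw [hgrad]
  linarith

/-- Convexity along the segment from `(x₀, t₀)` to `(x, 0)`: the derivative of a test function
touching `φ` from below is at most the increment of `φ`. -/
theorem fderiv_le_of_isLocalMin
    (hφ : ∀ x t, 0 ≤ t → IsGreatest (hopfAffine H x t '' conjEpigraph J) (φ x t))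
    {ψ : EuclideanSpace ℝ (Fin n) → ℝ → ℝ} {x₀ : EuclideanSpace ℝ (Fin n)} {t₀ : ℝ}
    (ht₀ : 0 < t₀) (hd : DifferentiableAt ℝ (Function.uncurry ψ) (x₀, t₀))
    (hmin : IsLocalMin (fun z : EuclideanSpace ℝ (Fin n) × ℝ => φ z.1 z.2 - ψ z.1 z.2) (x₀, t₀))
    (x : EuclideanSpace ℝ (Fin n)) :
    fderiv ℝ (Function.uncurry ψ) (x₀, t₀) (x - x₀, -t₀) ≤ J x - φ x₀ t₀ := by
  have hγ : HasDerivAt (fun s : ℝ => (x₀, t₀) + s • (x - x₀, -t₀)) (x - x₀, -t₀) 0 := by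
    simpa using ((hasDerivAt_id (0 : ℝ)).smul_const (x - x₀, -t₀)).const_add (x₀, t₀)
  have hγ0 : (x₀, t₀) + (0 : ℝ) • (x - x₀, -t₀) = (x₀, t₀) := by simp
  have hder : HasDerivAt (fun s : ℝ => Function.uncurry ψ ((x₀, t₀) + s • (x - x₀, -t₀)))
      (fderiv ℝ (Function.uncurry ψ) (x₀, t₀) (x - x₀, -t₀)) 0 := by
    refine HasFDerivAt.comp_hasDerivAt (l := Function.uncurry ψ) (0 : ℝ) ?_ hγ
    rw [hγ0]
    exact hd.hasFDerivAt
  have hlim := hder.tendsto_slope_zero_right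
  have hnear : ∀ᶠ s : ℝ in 𝓝[>] 0, φ x₀ t₀ - ψ x₀ t₀ ≤
      φ (x₀ + s • (x - x₀)) (t₀ + s * -t₀) - ψ (x₀ + s • (x - x₀)) (t₀ + s * -t₀) := by
    have h : Tendsto (fun s : ℝ => (x₀, t₀) + s • (x - x₀, -t₀)) (𝓝 0) (𝓝 (x₀, t₀)) := by
      simpa using hγ.continuousAt.tendsto
    exact (h.eventually hmin).filter_mono nhdsWithin_le_nhds
  refine le_of_tendsto hlim ?_
  filter_upwards [hnear, Ioo_mem_nhdsGT (zero_lt_one' ℝ)] with s hs hs01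
  have hconv : φ (x₀ + s • (x - x₀)) (t₀ + s * -t₀) ≤ (1 - s) * φ x₀ t₀ + s * J x := by
    obtain ⟨⟨p, hp, hval⟩, -⟩ := hφ (x₀ + s • (x - x₀)) (t₀ + s * -t₀)
      (by nlinarith [hs01.2])
    have h1 := mul_le_mul_of_nonneg_left ((hφ x₀ t₀ ht₀.le).2 (mem_image_of_mem _ hp))
      (sub_nonneg.2 hs01.2.le)
    have h2 := mul_le_mul_of_nonneg_left (hp x) hs01.1.le
    rw [← hval]
    simp only [hopfAffine, inner_add_right, real_inner_smul_right, inner_sub_right] at h1 ⊢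
    linarith
  rw [smul_eq_mul, inv_mul_le_iff₀ hs01.1]
  simp only [zero_add, zero_smul, add_zero, Function.uncurry, Prod.smul_mk, Prod.mk_add_mk,
    smul_eq_mul]
  linarith

/-- At a contact point from below, the slope `p` and time derivative `q` of the test function give
the affine minorant `⟨p, · - x₀⟩ - q t₀ + φ(x₀, t₀)` of `J`, that is, an upper bound for `J*(p)`;
comparing with the term `u = p` in the Hopf formula yields `0 ≤ t₀ (q + H(p))`. -/
theorem isViscositySupersolution_of_isGreatest
    (hφ : ∀ x t, 0 ≤ t → IsGreatest (hopfAffine H x t '' conjEpigraph J) (φ x t)) :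
    IsViscositySupersolution H φ := by
  intro ψ hψ x₀ t₀ ht₀ hmin
  have hd := differentiableAt_uncurry_of_contDiffOn hψ (x₀ := x₀) ht₀
  set p := ∇ (fun y => ψ y t₀) x₀
  set q := deriv (fun s => ψ x₀ s) t₀
  have hmem : (p, inner ℝ p x₀ + t₀ * q - φ x₀ t₀) ∈ conjEpigraph J := by
    intro y
    have h := fderiv_le_of_isLocalMin hφ ht₀ hd hmin y
    rw [fderiv_uncurry_apply hd, inner_sub_right] at h
    simp only
    linarith
  have h := (hφ x₀ t₀ ht₀.le).2 (mem_image_of_mem _ hmem)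
  simp only [hopfAffine] at h
  exact nonneg_of_mul_nonneg_right (a := t₀) (by linarith) ht₀

theorem isViscositySolution_of_isGreatest (hJ : ConvexOn ℝ univ J) (hH : Continuous H)
    (hbdd : ∃ (a : EuclideanSpace ℝ (Fin n)) (b : ℝ), ∀ u, inner ℝ a u + b ≤ H u)
    (hφ : ∀ x t, 0 ≤ t → IsGreatest (hopfAffine H x t '' conjEpigraph J) (φ x t)) :
    IsViscositySolution J H φ where
  continuousOn := continuousOn_of_isGreatest hJ.continuous_of_univ hH hbdd hφ
  initial x := eq_initial_of_isGreatest hJ (hφ x 0 le_rfl)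
  subsolution := isViscositySubsolution_of_isGreatest hφ
  supersolution := isViscositySupersolution_of_isGreatest hφ

end Viscosity

/-! ### The minimum of finitely many Hamiltonians -/

section Minimum

variable {n k : ℕ} [NeZero k] {J : EuclideanSpace ℝ (Fin n) → ℝ}
  {H : Fin k → EuclideanSpace ℝ (Fin n) → ℝ}

theorem continuous_minHamiltonian (hH : ∀ i, Continuous (H i)) :
    Continuous (minHamiltonian H) :=
  Continuous.finset_inf'_apply Finset.univ_nonempty fun i _ => hH i

theorem bddBelow_affine_minHamiltonian
    (hbdd : ∃ (a : EuclideanSpace ℝ (Fin n)) (b : ℝ), ∀ i u, inner ℝ a u + b ≤ H i u) :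
    ∃ (a : EuclideanSpace ℝ (Fin n)) (b : ℝ), ∀ u, inner ℝ a u + b ≤ minHamiltonian H u := by
  obtain ⟨a, b, h⟩ := hbdd
  exact ⟨a, b, fun u => Finset.le_inf' _ _ fun i _ => h i u⟩

/-- Both sides are the supremum of `⟨u, x⟩ - m - t H_i(u)` over all `i` and all `(u, m)`; here
`0 ≤ t` turns the minimum of the `H_i` into the maximum of the affine functions. -/
theorem maxHopf_eq_hopfFormula (hJ : ConvexOn ℝ univ J) (hH : ∀ i, Continuous (H i))
    (hbdd : ∃ (a : EuclideanSpace ℝ (Fin n)) (b : ℝ), ∀ i u, inner ℝ a u + b ≤ H i u)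
    (x : EuclideanSpace ℝ (Fin n)) {t : ℝ} (ht : 0 ≤ t) :
    maxHopf J H x t = hopfFormula J (minHamiltonian H) x t := by
  have hmin := isGreatest_hopfFormula hJ (continuous_minHamiltonian hH)
    (bddBelow_affine_minHamiltonian hbdd) x ht
  have hi : ∀ i, IsGreatest (hopfAffine (H i) x t '' conjEpigraph J) (hopfFormula J (H i) x t) :=
    fun i => isGreatest_hopfFormula hJ (hH i) (hbdd.imp fun a h => h.imp fun b h => h i) x ht
  apply le_antisymm
  · refine Finset.sup'_le _ _ fun i _ => ?_
    obtain ⟨p, hp, hval⟩ := (hi i).1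
    refine le_trans ?_ (hmin.2 (mem_image_of_mem _ hp))
    rw [← hval, hopfAffine, hopfAffine]
    gcongr
    exact Finset.inf'_le _ (Finset.mem_univ i)
  · obtain ⟨p, hp, hval⟩ := hmin.1
    obtain ⟨i, -, hip⟩ := Finset.exists_mem_eq_inf' Finset.univ_nonempty fun i => H i p.1
    have h : hopfFormula J (minHamiltonian H) x t = hopfAffine (H i) x t p := by
      rw [← hval, hopfAffine, hopfAffine, minHamiltonian, hip]
    rw [h]
    exact ((hi i).2 (mem_image_of_mem _ hp)).trans
      (Finset.le_sup' (fun i => hopfFormula J (H i) x t) (Finset.mem_univ i))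

end Minimum

theorem mainTheorem1 {n k : ℕ} [NeZero k]
    (J : EuclideanSpace ℝ (Fin n) → ℝ) (hJ : ConvexOn ℝ Set.univ J)
    (H : Fin k → EuclideanSpace ℝ (Fin n) → ℝ) (hH : ∀ i, Continuous (H i))
    (hbdd : ∃ (a : EuclideanSpace ℝ (Fin n)) (b : ℝ), ∀ i u, inner ℝ a u + b ≤ H i u) :
    -- each `φ_i` is finite, given by the Hopf formula (with a minimum), and a viscosity solution
    (∀ i, IsViscositySolution J (H i) (hopfFormula J (H i)) ∧
      ∀ (x : EuclideanSpace ℝ (Fin n)) (t : ℝ), 0 ≤ t →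
        ((hopfFormula J (H i) x t : ℝ) : EReal) = fenchelConj (hopfDual J (H i) t) x ∧
        IsLeast (Set.range fun u : EuclideanSpace ℝ (Fin n) =>
            fenchelConj (fun y => ((J y : ℝ) : EReal)) u + ((t * H i u : ℝ) : EReal)
              - ((inner ℝ u x : ℝ) : EReal))
          ((-hopfFormula J (H i) x t : ℝ) : EReal)) ∧
    -- `max_i φ_i(x,t) = - min_u {J*(u) + t min_i H_i(u) - ⟨u, x⟩}`
    (∀ (x : EuclideanSpace ℝ (Fin n)) (t : ℝ), 0 ≤ t →
      IsLeast (Set.range fun u : EuclideanSpace ℝ (Fin n) =>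
          fenchelConj (fun y => ((J y : ℝ) : EReal)) u + ((t * minHamiltonian H u : ℝ) : EReal)
            - ((inner ℝ u x : ℝ) : EReal))
        ((-maxHopf J H x t : ℝ) : EReal)) ∧
    -- `max_i φ_i` is the Hopf-formula solution for the Hamiltonian `min_i H_i`
    (∀ (x : EuclideanSpace ℝ (Fin n)) (t : ℝ), 0 ≤ t →
      ((maxHopf J H x t : ℝ) : EReal) = fenchelConj (hopfDual J (minHamiltonian H) t) x) ∧
    -- and it is a viscosity solution of the Cauchy problem with Hamiltonian `min_i H_i`
    IsViscositySolution J (minHamiltonian H) (maxHopf J H) := by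
  have hbdd' : ∀ i, ∃ (a : EuclideanSpace ℝ (Fin n)) (b : ℝ), ∀ u, inner ℝ a u + b ≤ H i u :=
    fun i => hbdd.imp fun a h => h.imp fun b h => h i
  have hmin := continuous_minHamiltonian hH
  have hminb := bddBelow_affine_minHamiltonian hbdd
  refine ⟨fun i => ⟨?_, fun x t ht => ⟨?_, ?_⟩⟩, fun x t ht => ?_, fun x t ht => ?_, ?_⟩
  · exact isViscositySolution_of_isGreatest hJ (hH i) (hbdd' i) fun x t ht =>
      isGreatest_hopfFormula hJ (hH i) (hbdd' i) x ht
  · exact coe_hopfFormula hJ (hH i) (hbdd' i) x ht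
  · exact isLeast_neg_hopfFormula hJ (hH i) (hbdd' i) x ht
  · rw [maxHopf_eq_hopfFormula hJ hH hbdd x ht]
    exact isLeast_neg_hopfFormula hJ hmin hminb x ht
  · rw [maxHopf_eq_hopfFormula hJ hH hbdd x ht]
    exact coe_hopfFormula hJ hmin hminb x ht
  · refine isViscositySolution_of_isGreatest hJ hmin hminb fun x t ht => ?_
    rw [maxHopf_eq_hopfFormula hJ hH hbdd x ht]
    exact isGreatest_hopfFormula hJ hmin hminb x ht
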